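/- A centred Catalan set of size $m\ge 1$ is an $m$-element subset $S$ of $\{-m+1,\dots,m-1\}$ such that $|S\cap\{-i,\dots,i\}|\ge i+1$ for all $0\le i\le m-1$. For integers $n\ge 0$ and $l\ge 1$, an $(n,l)$-AS-trapezoid is an array of $n$ centred rows with entries in $\{-1,0,1\}$, the $i$-th row from the bottom having $l+2i-1$ entries, such that all row-sums are $1$, the column-sums are $0$ for the central $l-1$ columns, the non-zero entries alternate in sign in every row and every column, and in every column the first non-zero entry from the top is positive. (For $n=0$ there is exactly one, the empty array.) Label its columns from left to right by $-n+1,\dots,l+n-1$. Its associated set $\mathcal S(A)$ is obtained by taking the labels of all columns with positive column-sum, subtracting $1$ from the non-positive labels, subtracting $l-1$ from the positive labels, and adding $0$ as an element. For a centred Catalan set $S$ of size $n+1$, let $w_l(S)$ be the number of $(n,l)$-AS-trapezoids $A$ with $\mathcal S(A)=S$. **Proposition.** Let $S$ be a centred Catalan set. Then $w_l(S)$, for integers $l\ge 1$, is given by a (unique) polynomial in $\mathbb Q[l]$, again denoted by $w_l(S)$, and in $\mathbb Q[l]$ $$\{-1,1\}\subset S \iff (l+1)\mid w_l(S),$$ $$\{-2,-1,1,2\}\subset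 S \iff (l+1)(l+2)\mid w_l(S).$$ -/

import Mathlib

open Polynomial

/-- `S` is a centred Catalan set of size `n` (where `n ≥ 1`): an `n`-element subset of
`{-n+1, …, n-1}` with `|S ∩ {-i, …, i}| ≥ i + 1` for all `0 ≤ i ≤ n - 1`. -/
structure IsCentredCatalanSet (n : ℕ) (S : Finset ℤ) : Prop where
  pos : 1 ≤ n
  card_eq : S.card = n
  subset_Icc : S ⊆ Finset.Icc (-(n : ℤ) + 1) ((n : ℤ) - 1)
  le_card_inter : ∀ i : ℕ, i < n → i + 1 ≤ (S ∩ Finset.Icc (-(i : ℤ)) (i : ℤ)).card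

/-- `A` is an `(n, l)`-AS-trapezoid.

The rows are numbered `0, …, n-1` from bottom to top and the columns carry the labels
`-n+1, …, l+n-1` from left to right. Row `i` occupies exactly the columns `-i, …, l+i`
(so it has `l + 2 (i + 1) - 1` entries), and `A` is extended by `0` outside the trapezoid.
The central `l - 1` columns are those with labels `1, …, l-1`. -/
structure IsASTrapezoid (n l : ℕ) (A : Fin n → ℤ → ℤ) : Prop where
  eq_zero_outside : ∀ (i : Fin n) (j : ℤ), ¬ (-(i : ℤ) ≤ j ∧ j ≤ (l : ℤ) + (i : ℤ)) → A i j = 0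
  entries : ∀ (i : Fin n) (j : ℤ), A i j = -1 ∨ A i j = 0 ∨ A i j = 1
  row_sum : ∀ i : Fin n, ∑ j ∈ Finset.Icc (-(i : ℤ)) ((l : ℤ) + (i : ℤ)), A i j = 1
  central_col_sum : ∀ j : ℤ, 1 ≤ j → j ≤ (l : ℤ) - 1 → ∑ i : Fin n, A i j = 0
  /-- consecutive non-zero entries of a row have opposite signs -/
  row_alternating : ∀ (i : Fin n) (j j' : ℤ), j < j' → A i j ≠ 0 → A i j' ≠ 0 →
    (∀ k : ℤ, j < k → k < j' → A i k = 0) → A i j' = -A i j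
  /-- consecutive non-zero entries of a column have opposite signs -/
  col_alternating : ∀ (i i' : Fin n) (j : ℤ), i < i' → A i j ≠ 0 → A i' j ≠ 0 →
    (∀ k : Fin n, i < k → k < i' → A k j = 0) → A i' j = -A i j
  /-- in every column the first non-zero entry from the top is positive -/
  col_top_pos : ∀ (i : Fin n) (j : ℤ), A i j ≠ 0 → (∀ k : Fin n, i < k → A k j = 0) → 0 < A i j

/-- The centred Catalan set of an `(n, l)`-AS-trapezoid: take the labels of the columns with
positive column-sum, subtract `1` from the non-positive labels, subtract `l - 1` from the
positive labels, and add the element `0`. -/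
noncomputable def trapezoidSet (n l : ℕ) (A : Fin n → ℤ → ℤ) : Finset ℤ :=
  insert 0
    (((Finset.Icc (-(n : ℤ) + 1) ((l : ℤ) + (n : ℤ) - 1)).filter
        (fun j => 0 < ∑ i : Fin n, A i j)).image
      (fun j => if j ≤ 0 then j - 1 else j - ((l : ℤ) - 1)))

/-- The weight `w_l(S)` of a centred Catalan set `S` of size `n + 1`: the number of
`(n, l)`-AS-trapezoids whose centred Catalan set is `S`. -/
noncomputable def trapezoidWeight (n l : ℕ) (S : Finset ℤ) : ℕ :=
  Set.ncard {A : Fin n → ℤ → ℤ | IsASTrapezoid n l A ∧ trapezoidSet n l A = S}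

/-! A row or column obeys its sign conditions exactly when its partial sums (from the left,
respectively from the top) lie in {0, 1}, with total 1 for a row. Let `K` list the columns of sum 1
in the range of the bottom row, and `M` those in the same range once that row is deleted. The row is
the difference of the indicators of `K` and `M`, and the partial-sum condition says that `M`
interlaces `K`. Deleting rows from the bottom thus turns the count into an iterated sum over
strictly increasing interlacing lists, where each new row may contribute its two end columns `a` and
`b` to the list, as prescribed by S. This sum is `weight`, and `ncard_arraysWith` and
`trapezoidWeight_eq_weight` identify it with the count.

Read with signed sums, `weight` makes sense for all integers `a`, `b`. Summing a polynomial between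
polynomial bounds gives a polynomial, so `weight` at `a = 0`, `b = l` is a polynomial in l
(`exists_polynomial_eval_eq_weight`), and its values at negative l come from the same recursion.
Divisibility becomes vanishing at l = -1 and l = -2.

There the first one or two rows collapse. If both end columns are prescribed, the signed sum cancels
at l = -1; the next row does the same at l = -2. Otherwise what remains is, up to sign, a `weight`
with `a < b`, a genuine sum over interlacing lists, and the Catalan inequalities make it positive
(`weight_pos`). This gives `IsBalanced.weight_neg_one` and `IsBalanced.weight_neg_two`. -/

/-! ### Signed sums and Faulhaber's formula. -/

/-- The signed sum of `f` over `[a, b)`, which is a polynomial in `a` and `b` if `f` is. -/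
noncomputable def signedSum (f : ℤ → ℚ) (a b : ℤ) : ℚ :=
  ∑ m ∈ Finset.Ico a b, f m - ∑ m ∈ Finset.Ico b a, f m

lemma signedSum_of_le (f : ℤ → ℚ) {a b : ℤ} (h : a ≤ b) :
    signedSum f a b = ∑ m ∈ Finset.Ico a b, f m := by
  simp [signedSum, Finset.Ico_eq_empty_of_le h]

lemma signedSum_of_ge (f : ℤ → ℚ) {a b : ℤ} (h : b ≤ a) :
    signedSum f a b = - ∑ m ∈ Finset.Ico b a, f m := by
  simp [signedSum, Finset.Ico_eq_empty_of_le h]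

lemma sum_Ico_eq_sub {f F : ℤ → ℚ} (h : ∀ m, F (m + 1) - F m = f m) {a b : ℤ} (hab : a ≤ b) :
    ∑ m ∈ Finset.Ico a b, f m = F b - F a := by
  induction b, hab using Int.leInduction with
  | base => simp
  | succ b hb ih =>
    have : Finset.Ico a (b + 1) = insert b (Finset.Ico a b) := by
      ext x; simp only [Finset.mem_Ico, Finset.mem_insert]; omega
    rw [this, Finset.sum_insert (by simp), ih, ← h b]
    ring

lemma signedSum_eq_sub {f F : ℤ → ℚ} (h : ∀ m, F (m + 1) - F m = f m) (a b : ℤ) :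
    signedSum f a b = F b - F a := by
  rcases le_total a b with hab | hab
  · rw [signedSum_of_le f hab, sum_Ico_eq_sub h hab]
  · rw [signedSum_of_ge f hab, sum_Ico_eq_sub h hab, neg_sub]

lemma signedSum_add (f g : ℤ → ℚ) (a b : ℤ) :
    signedSum (fun m => f m + g m) a b = signedSum f a b + signedSum g a b := by
  simp only [signedSum, Finset.sum_add_distrib]
  ring

/-- The Bernoulli polynomial of degree d + 1, divided by d + 1, is a discrete antiderivative of the
d-th power. -/
lemma signedSum_const_mul_pow (c : ℚ) (d : ℕ) (a b : ℤ) :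
    signedSum (fun m => c * (m : ℚ) ^ d) a b =
      c / (d + 1) * ((Polynomial.bernoulli (d + 1)).eval (b : ℚ) -
        (Polynomial.bernoulli (d + 1)).eval (a : ℚ)) := by
  rw [signedSum_eq_sub (F := fun m => c / (d + 1) * (Polynomial.bernoulli (d + 1)).eval (m : ℚ)),
    mul_sub]
  intro m
  have h := Polynomial.bernoulli_eval_one_add (d + 1) (m : ℚ)
  have hd : (d : ℚ) + 1 ≠ 0 := by positivity
  push_cast at h ⊢
  rw [add_comm (m : ℚ) 1, h]
  field_simp
  simp
  ring

/-! ### Polynomiality, as closure of algebras of functions on a parameter space. -/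

variable {Ω : Type}

/-- The functions on `Ω × ℤ` that are polynomial in the second variable, with coefficients
in `𝒜`. -/
noncomputable def polynomialExtension (𝒜 : Subalgebra ℚ (Ω → ℚ)) : Subalgebra ℚ (Ω × ℤ → ℚ) where
  carrier := {h | ∃ p : Polynomial 𝒜, ∀ ω m,
    h (ω, m) = (p.map (algebraMap 𝒜 (Ω → ℚ))).eval (fun _ => (m : ℚ)) ω}
  mul_mem' := by
    rintro f g ⟨p, hp⟩ ⟨q, hq⟩
    exact ⟨p * q, fun ω m => by simp [hp, hq]⟩
  add_mem' := by
    rintro f g ⟨p, hp⟩ ⟨q, hq⟩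
    exact ⟨p + q, fun ω m => by simp [hp, hq]⟩
  algebraMap_mem' c := ⟨C (algebraMap ℚ 𝒜 c), fun ω m => by
    rw [Polynomial.map_C, Polynomial.eval_C]; rfl⟩

lemma fst_mem_polynomialExtension {𝒜 : Subalgebra ℚ (Ω → ℚ)} {g : Ω → ℚ} (hg : g ∈ 𝒜) :
    (fun x : Ω × ℤ => g x.1) ∈ polynomialExtension 𝒜 :=
  ⟨C ⟨g, hg⟩, fun ω m => by rw [Polynomial.map_C, Polynomial.eval_C]; rfl⟩

lemma snd_mem_polynomialExtension (𝒜 : Subalgebra ℚ (Ω → ℚ)) :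
    (fun x : Ω × ℤ => (x.2 : ℚ)) ∈ polynomialExtension 𝒜 :=
  ⟨X, fun ω m => by simp⟩

lemma eval_mem {𝒜 : Subalgebra ℚ (Ω → ℚ)} {g : Ω → ℚ} (hg : g ∈ 𝒜) (p : ℚ[X]) :
    (fun ω => p.eval (g ω)) ∈ 𝒜 := by
  induction p using Polynomial.induction_on' with
  | add p q hp hq => simp only [Polynomial.eval_add]; exact 𝒜.add_mem hp hq
  | monomial n c =>
    simp only [Polynomial.eval_monomial]; exact 𝒜.smul_mem (𝒜.pow_mem hg n) c

/-- By additivity the summand may be taken to be a monomial in the summation variable with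
coefficient in `𝒜`; its signed sum is then polynomial in the two bounds. -/
lemma signedSum_mem {𝒜 : Subalgebra ℚ (Ω → ℚ)} {h : Ω × ℤ → ℚ} (hh : h ∈ polynomialExtension 𝒜)
    {a b : Ω → ℤ} (ha : (fun ω => (a ω : ℚ)) ∈ 𝒜) (hb : (fun ω => (b ω : ℚ)) ∈ 𝒜) :
    (fun ω => signedSum (fun m => h (ω, m)) (a ω) (b ω)) ∈ 𝒜 := by
  obtain ⟨p, hp⟩ := hh
  simp only [hp]
  clear hp
  induction p using Polynomial.induction_on' with
  | add p q hp hq =>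
    simp only [Polynomial.map_add, Polynomial.eval_add, Pi.add_apply, signedSum_add]
    exact 𝒜.add_mem hp hq
  | monomial n c =>
    have h1 : ∀ ω, signedSum (fun m => ((Polynomial.monomial n c).map
        (algebraMap 𝒜 (Ω → ℚ))).eval (fun _ => (m : ℚ)) ω) (a ω) (b ω) =
        (c : Ω → ℚ) ω * ((1 / ((n : ℚ) + 1)) *
          ((Polynomial.bernoulli (n + 1)).eval (b ω : ℚ) -
            (Polynomial.bernoulli (n + 1)).eval (a ω : ℚ))) := by
      intro ω
      rw [← mul_assoc, mul_one_div, ← signedSum_const_mul_pow]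
      simp
    simp only [h1]
    exact 𝒜.mul_mem c.2 (𝒜.smul_mem (𝒜.sub_mem (eval_mem hb _) (eval_mem ha _)) _)

/-! ### Interlacing sums and the polynomial weight. -/

/-- The signed sum of `f` over all strictly increasing lists that interlace `k :: L`. -/
noncomputable def interlacingSum : ℤ → List ℤ → (List ℤ → ℚ) → ℚ
  | _, [], f => f []
  | k, k' :: L, f => signedSum (fun m => interlacingSum k' L (fun M => f (m :: M))) k k' +
      interlacingSum (k' + 1) L (fun M => f (k' :: M))

/-- `f` is given by a polynomial on the lists of any given length. -/
def IsPolynomialOnLists (f : List ℤ → ℚ) : Prop :=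
  ∀ (Ω : Type) (𝒜 : Subalgebra ℚ (Ω → ℚ)) (K : List (Ω → ℤ)),
    (∀ κ ∈ K, (fun ω => (κ ω : ℚ)) ∈ 𝒜) → (fun ω => f (K.map (fun κ => κ ω))) ∈ 𝒜

/-- `P` holds the entries already chosen. Each summation variable becomes a new coordinate, so the
induction passes from `Ω` to `Ω × ℤ` and must vary the parameter space and the algebra. -/
lemma interlacingSum_mem {f : List ℤ → ℚ} (hf : IsPolynomialOnLists f) (L : List (Ω → ℤ))
    (𝒜 : Subalgebra ℚ (Ω → ℚ)) (P : List (Ω → ℤ)) (k : Ω → ℤ)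
    (hL : ∀ κ ∈ L, (fun ω => (κ ω : ℚ)) ∈ 𝒜) (hP : ∀ κ ∈ P, (fun ω => (κ ω : ℚ)) ∈ 𝒜)
    (hk : (fun ω => (k ω : ℚ)) ∈ 𝒜) :
    (fun ω => interlacingSum (k ω) (L.map (fun κ => κ ω))
      (fun M => f (P.map (fun κ => κ ω) ++ M))) ∈ 𝒜 := by
  obtain ⟨r, hr⟩ : ∃ r, L.length = r := ⟨_, rfl⟩
  induction r generalizing Ω L P k with
  | zero =>
    obtain rfl := List.length_eq_zero_iff.1 hr
    simpa [interlacingSum] using hf Ω 𝒜 P hP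
  | succ r ih =>
    obtain ⟨k', L, rfl⟩ : ∃ k' L', L = k' :: L' := by
      cases L with
      | nil => simp at hr
      | cons a t => exact ⟨a, t, rfl⟩
    simp only [List.mem_cons, forall_eq_or_imp] at hL
    have hr' : L.length = r := by simpa using hr
    refine 𝒜.add_mem ?_ ?_
    · refine signedSum_mem (h := fun x => interlacingSum (k' x.1) (L.map (fun κ => κ x.1))
        (fun M => f (P.map (fun κ => κ x.1) ++ x.2 :: M))) ?_ hk hL.1
      have := ih (L.map (fun κ (x : Ω × ℤ) => κ x.1)) (polynomialExtension 𝒜)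
        (P.map (fun κ (x : Ω × ℤ) => κ x.1) ++ [fun x => x.2]) (fun x => k' x.1) ?_ ?_ ?_
        (by simpa using hr')
      · simpa [Function.comp_def] using this
      · simp only [List.mem_map, forall_exists_index, and_imp, forall_apply_eq_imp_iff₂]
        exact fun κ h => fst_mem_polynomialExtension (hL.2 κ h)
      · simp only [List.mem_append, List.mem_map, List.mem_singleton]
        rintro κ (⟨κ, h, rfl⟩ | rfl)
        · exact fst_mem_polynomialExtension (hP κ h)
        · exact snd_mem_polynomialExtension 𝒜
      · exact fst_mem_polynomialExtension hL.1
    · have := ih L 𝒜 (P ++ [k']) (fun ω => k' ω + 1) hL.2 ?_ ?_ hr'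
      · simpa using this
      · simp only [List.mem_append, List.mem_singleton]
        rintro κ (h | rfl)
        · exact hP κ h
        · exact hL.1
      · simp only [Int.cast_add, Int.cast_one]
        exact 𝒜.add_mem hL.1 𝒜.one_mem

/-- Add `a` on the left of `K` if `x` is set, and `b` on the right if `y` is set. -/
def extendList (x y : Bool) (a b : ℤ) (K : List ℤ) : List ℤ :=
  (if x then [a] else []) ++ K ++ (if y then [b] else [])

/-- `interlacingSum` for a list that may be empty. -/
noncomputable def interlacingSum' : List ℤ → (List ℤ → ℚ) → ℚ
  | [], _ => 0
  | k :: L, f => interlacingSum k L f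

/-- The polynomial weight: the pair of Booleans number `i` in `s` says whether the columns
`a - i` and `b + i` have sum `1`, and `K` lists the columns strictly between `a` and `b` that
have sum `1`. -/
noncomputable def weight : List (Bool × Bool) → ℤ → ℤ → List ℤ → ℚ
  | [], _, _, K => if K = [] then 1 else 0
  | (x, y) :: s, a, b, K => interlacingSum' (extendList x y a b K) (weight s (a - 1) (b + 1))

lemma weight_mem (s : List (Bool × Bool)) (Ω : Type) (𝒜 : Subalgebra ℚ (Ω → ℚ)) (a b : Ω → ℤ)
    (K : List (Ω → ℤ)) (ha : (fun ω => (a ω : ℚ)) ∈ 𝒜) (hb : (fun ω => (b ω : ℚ)) ∈ 𝒜)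
    (hK : ∀ κ ∈ K, (fun ω => (κ ω : ℚ)) ∈ 𝒜) :
    (fun ω => weight s (a ω) (b ω) (K.map (fun κ => κ ω))) ∈ 𝒜 := by
  induction s generalizing Ω K with
  | nil =>
    cases K with
    | nil => exact 𝒜.one_mem
    | cons => exact 𝒜.zero_mem
  | cons xy s ih =>
    obtain ⟨x, y⟩ := xy
    set K' : List (Ω → ℤ) := (if x then [a] else []) ++ K ++ (if y then [b] else []) with hK'
    have hK'm : ∀ κ ∈ K', (fun ω => (κ ω : ℚ)) ∈ 𝒜 := by
      intro κ h
      simp only [hK', List.mem_append] at h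
      rcases h with (h | h) | h
      · cases x <;> simp at h
        exact h ▸ ha
      · exact hK κ h
      · cases y <;> simp at h
        exact h ▸ hb
    have hext : ∀ ω, extendList x y (a ω) (b ω) (K.map (fun κ => κ ω)) =
        K'.map (fun κ => κ ω) := by
      intro ω
      cases x <;> cases y <;> simp [extendList, hK']
    simp only [weight, hext]
    clear_value K'
    cases K' with
    | nil => exact 𝒜.zero_mem
    | cons k L =>
      simp only [List.mem_cons, forall_eq_or_imp] at hK'm
      -- The remaining weight depends on `a` and `b` as well as on the chosen list, so they travel
      -- as its first two entries. The default value never occurs in the use below.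
      let f : List ℤ → ℚ := fun
        | a :: b :: M => weight s (a - 1) (b + 1) M
        | _ => 0
      have hf : IsPolynomialOnLists f := by
        intro Ω 𝒜 K hK
        match K, hK with
        | [], _ => exact 𝒜.zero_mem
        | [_], _ => exact 𝒜.zero_mem
        | a :: b :: M, hK =>
          simp only [List.mem_cons, forall_eq_or_imp] at hK
          refine ih Ω 𝒜 (fun ω => a ω - 1) (fun ω => b ω + 1) M ?_ ?_ hK.2.2
          · simp only [Int.cast_sub, Int.cast_one]
            exact 𝒜.sub_mem hK.1 𝒜.one_mem
          · simp only [Int.cast_add, Int.cast_one]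
            exact 𝒜.add_mem hK.2.1 𝒜.one_mem
      exact interlacingSum_mem hf L 𝒜 [a, b] k hK'm.2 (by simp [ha, hb]) hK'm.1

/-- The parameter space is ℤ itself, with the algebra of polynomial functions and `b` the identity.
The equality holds at every integer, including the negative ones needed later. -/
lemma exists_polynomial_eval_eq_weight (s : List (Bool × Bool)) :
    ∃ w : ℚ[X], ∀ l : ℤ, w.eval (l : ℚ) = weight s 0 l [] := by
  have := weight_mem s ℤ ((Polynomial.aeval (fun l : ℤ => (l : ℚ)) :
    ℚ[X] →ₐ[ℚ] (ℤ → ℚ)).range) (fun _ => 0) id [] ?_ ?_ (by simp)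
  · obtain ⟨w, hw⟩ := this
    refine ⟨w, fun l => ?_⟩
    have := congrFun hw l
    simp only [id, List.map_nil] at this
    rw [← this]
    exact (Polynomial.aeval_fn_apply w (fun l : ℤ => (l : ℚ)) l).symm
  · simp only [Int.cast_zero]
    exact Subalgebra.zero_mem _
  · exact ⟨X, by ext; simp⟩

/-! ### Interlacing lists: the genuine sums behind the signed ones. -/

/-- The strictly increasing lists that interlace `k :: L`. -/
noncomputable def interlacingLists : ℤ → List ℤ → Finset (List ℤ)
  | _, [] => {[]}
  | k, k' :: L =>
    (Finset.Ico k k').biUnion (fun m => (interlacingLists k' L).image (fun M => m :: M)) ∪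
      (interlacingLists (k' + 1) L).image (fun M => k' :: M)

/-- `M` interlaces `k :: L`. -/
def Interlaces : ℤ → List ℤ → List ℤ → Prop
  | _, [], M => M = []
  | _, _ :: _, [] => False
  | k, k' :: L, m :: M => k ≤ m ∧ m ≤ k' ∧ Interlaces k' L M

lemma Interlaces.le {k : ℤ} {L M : List ℤ} (hL : (k :: L).Pairwise (· ≤ ·))
    (h : Interlaces k L M) : ∀ m ∈ M, k ≤ m := by
  induction L generalizing k M with
  | nil => cases h; simp
  | cons k' L ih =>
    cases M with
    | nil => simp
    | cons m M =>
      intro x hx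
      rcases List.mem_cons.1 hx with rfl | hx
      · exact h.1
      · exact (List.rel_of_pairwise_cons hL (by simp)).trans (ih hL.of_cons h.2.2 x hx)

lemma interlaces_succ_iff {k : ℤ} {L M : List ℤ} :
    Interlaces (k + 1) L M ↔ Interlaces k L M ∧ ∀ m ∈ M.head?, k < m := by
  cases L <;> cases M <;> simp [Interlaces]
  constructor
  · rintro ⟨h1, h2, h3⟩
    exact ⟨⟨by omega, h2, h3⟩, by omega⟩
  · rintro ⟨⟨h1, h2, h3⟩, h⟩
    exact ⟨by omega, h2, h3⟩

lemma mem_interlacingLists {k : ℤ} {L M : List ℤ} (hL : L.Pairwise (· < ·))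
    (hk : ∀ x ∈ L, k ≤ x) :
    M ∈ interlacingLists k L ↔ M.Pairwise (· < ·) ∧ Interlaces k L M := by
  induction L generalizing k M with
  | nil =>
    simp only [interlacingLists, Finset.mem_singleton, Interlaces]
    exact ⟨fun h => ⟨by simp [h], h⟩, fun h => h.2⟩
  | cons k' L ih =>
    have hL' := List.pairwise_cons.1 hL
    cases M with
    | nil => simp [interlacingLists, Interlaces]
    | cons m M =>
      have e1 : m :: M ∈ interlacingLists k (k' :: L) ↔
          ((k ≤ m ∧ m < k') ∧ M ∈ interlacingLists k' L) ∨
            (m = k' ∧ M ∈ interlacingLists (k' + 1) L) := by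
        simp only [interlacingLists, Finset.mem_union, Finset.mem_biUnion, Finset.mem_Ico,
          Finset.mem_image, List.cons.injEq]
        constructor
        · rintro (⟨_, h, _, h', rfl, rfl⟩ | ⟨_, h', rfl, rfl⟩)
          · exact Or.inl ⟨h, h'⟩
          · exact Or.inr ⟨rfl, h'⟩
        · rintro (⟨h, h'⟩ | ⟨rfl, h'⟩)
          · exact Or.inl ⟨m, h, M, h', rfl, rfl⟩
          · exact Or.inr ⟨M, h', rfl, rfl⟩
      rw [e1, ih hL'.2 (fun x hx => (hL'.1 x hx).le),
        ih hL'.2 (fun x hx => hL'.1 x hx), interlaces_succ_iff, List.pairwise_cons]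
      have hkk' : k ≤ k' := hk k' (by simp)
      simp only [Interlaces]
      constructor
      · rintro (⟨⟨h1, h2⟩, h3, h4⟩ | ⟨rfl, h3, h4, h5⟩)
        · refine ⟨⟨fun x hx => h2.trans_le (h4.le (hL.imp le_of_lt) x hx), h3⟩, h1, h2.le, h4⟩
        · refine ⟨⟨?_, h3⟩, hkk', le_rfl, h4⟩
          cases M with
          | nil => simp
          | cons m' M =>
            have := h5 m' (by simp)
            intro x hx
            rcases List.mem_cons.1 hx with rfl | hx
            · exact this
            · exact this.trans (List.rel_of_pairwise_cons h3 hx)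
      · rintro ⟨⟨h1, h2⟩, h3, h4, h5⟩
        rcases h4.lt_or_eq with h | rfl
        · exact Or.inl ⟨⟨h3, h⟩, h2, h5⟩
        · refine Or.inr ⟨rfl, h2, h5, fun x hx => h1 x (List.mem_of_mem_head? hx)⟩

/-- For increasing bounds no sign occurs. The two branches of the recursion are separated by whether
the first entry is below `k'` or equal to it; in the latter case strictness forces the next entry to
start at `k' + 1`. -/
lemma interlacingSum_eq_sum {k : ℤ} {L : List ℤ} (hL : L.Pairwise (· < ·))
    (hk : ∀ x ∈ L, k ≤ x) (f : List ℤ → ℚ) :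
    interlacingSum k L f = ∑ M ∈ interlacingLists k L, f M := by
  induction L generalizing k f with
  | nil => simp [interlacingSum, interlacingLists]
  | cons k' L ih =>
    have hL' := List.pairwise_cons.1 hL
    rw [interlacingSum, interlacingLists, Finset.sum_union, Finset.sum_biUnion,
      signedSum_of_le _ (hk k' (by simp)), Finset.sum_image (by simp),
      ih hL'.2 (fun x hx => hL'.1 x hx)]
    · congr 1
      refine Finset.sum_congr rfl fun m _ => ?_
      rw [Finset.sum_image (by simp), ih hL'.2 (fun x hx => (hL'.1 x hx).le)]
    · intro m _ m' _ hmm'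
      simp only [Function.onFun, Finset.disjoint_left, Finset.mem_image, not_exists, not_and]
      rintro _ ⟨M, _, rfl⟩ M' _ h
      exact hmm' (List.cons.inj h).1.symm
    · simp only [Finset.disjoint_left, Finset.mem_biUnion, Finset.mem_image, Finset.mem_Ico,
        not_exists, not_and]
      rintro _ ⟨m, hm, M, _, rfl⟩ M' _ h
      exact hm.2.ne' (List.cons.inj h).1

/-! ### Rows as differences of indicators of interlacing lists. -/

/-- The number of elements of `K` that are at most `x`. -/
def countLE (K : List ℤ) (x : ℤ) : ℕ := K.countP (· ≤ x)

lemma countLE_cons (k : ℤ) (K : List ℤ) (x : ℤ) :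
    countLE (k :: K) x = countLE K x + if k ≤ x then 1 else 0 := by
  simp [countLE, List.countP_cons]

lemma countLE_eq_zero {K : List ℤ} {x : ℤ} (h : ∀ k ∈ K, x < k) : countLE K x = 0 := by
  simpa [countLE, List.countP_eq_zero] using h

/-- Scanning from the left, interlacing means that entries of `k :: L` and of `M` are met
alternately, beginning with `k`; so the first count leads the second by 0 or 1. -/
lemma interlaces_iff_countLE {k : ℤ} {L M : List ℤ} (hL : (k :: L).Pairwise (· ≤ ·))
    (hM : M.Pairwise (· ≤ ·)) :
    Interlaces k L M ↔ L.length = M.length ∧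
      ∀ x, countLE M x ≤ countLE (k :: L) x ∧ countLE (k :: L) x ≤ countLE M x + 1 := by
  induction L generalizing k M with
  | nil =>
    cases M with
    | nil =>
      simp only [Interlaces, true_iff]
      refine ⟨trivial, fun x => ?_⟩
      rw [countLE_cons]
      simp only [countLE, List.countP_nil]
      split_ifs <;> omega
    | cons m M => simp [Interlaces]
  | cons k' L ih =>
    cases M with
    | nil => simp [Interlaces]
    | cons m M =>
      have hkL := List.pairwise_cons.1 hL
      have hkL' := List.pairwise_cons.1 hkL.2
      have hmM := List.pairwise_cons.1 hM
      have hkk' : k ≤ k' := hkL.1 k' (by simp)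
      simp only [Interlaces, ih hkL.2 hmM.2, List.length_cons, Nat.add_right_cancel_iff]
      constructor
      · rintro ⟨h1, h2, h3, h4⟩
        refine ⟨h3, fun x => ?_⟩
        have := h4 x
        rw [countLE_cons k, countLE_cons m]
        by_cases hx : m ≤ x
        · rw [if_pos hx, if_pos (h1.trans hx)]
          omega
        · rw [if_neg hx, countLE_eq_zero (K := M) (fun y hy => by have := hmM.1 y hy; omega),
            countLE_eq_zero (K := k' :: L)]
          · split_ifs <;> omega
          · intro y hy
            rcases List.mem_cons.1 hy with rfl | hy
            · omega
            · have := hkL'.1 y hy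
              omega
      · rintro ⟨h3, h4⟩
        have h1 : k ≤ m := by
          by_contra! h
          have := (h4 m).1
          rw [countLE_eq_zero (K := k :: k' :: L), countLE_cons, if_pos le_rfl] at this
          · omega
          · intro y hy
            rcases List.mem_cons.1 hy with rfl | hy
            · exact h
            · exact h.trans_le (hkL.1 y hy)
        have h2 : m ≤ k' := by
          by_contra! h
          have := (h4 k').2
          rw [countLE_eq_zero (K := m :: M), countLE_cons, countLE_cons, if_pos le_rfl,
            if_pos hkk'] at this
          · omega
          · intro y hy
            rcases List.mem_cons.1 hy with rfl | hy
            · exact h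
            · exact h.trans_le (hmM.1 y hy)
        refine ⟨h1, h2, h3, fun x => ?_⟩
        by_cases hx : m ≤ x
        · have := h4 x
          rw [countLE_cons k, countLE_cons m, if_pos hx, if_pos (h1.trans hx)] at this
          omega
        · rw [countLE_eq_zero (K := M) (fun y hy => by have := hmM.1 y hy; omega),
            countLE_eq_zero (K := k' :: L)]
          · omega
          · intro y hy
            rcases List.mem_cons.1 hy with rfl | hy
            · omega
            · have := hkL'.1 y hy
              omega

/-- The indicator function of the set of entries of `K`. -/
def listIndicator (K : List ℤ) (j : ℤ) : ℤ := if j ∈ K then 1 else 0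

lemma sum_listIndicator {K : List ℤ} (hK : K.Nodup) (a x : ℤ) (ha : ∀ k ∈ K, a ≤ k) :
    ∑ j ∈ Finset.Icc a x, listIndicator K j = countLE K x := by
  simp only [listIndicator, Finset.sum_boole, countLE]
  rw [List.countP_eq_length_filter, ← List.toFinset_card_of_nodup (hK.filter _)]
  congr 2
  ext j
  simp only [Finset.mem_filter, Finset.mem_Icc, List.mem_toFinset, List.mem_filter,
    decide_eq_true_eq]
  exact ⟨fun h => ⟨h.2, h.1.2⟩, fun h => ⟨⟨ha j h.1, h.2⟩, h.1⟩⟩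

lemma countLE_eq_length {K : List ℤ} {x : ℤ} (h : ∀ k ∈ K, k ≤ x) : countLE K x = K.length := by
  simpa [countLE, List.countP_eq_length] using h

/-- `r` is a row whose non-zero entries lie in the columns `a, …, b`, with partial sums in
`{0, 1}` and sum `1`. -/
structure IsRow (a b : ℤ) (r : ℤ → ℤ) : Prop where
  eq_zero : ∀ j, ¬ (a ≤ j ∧ j ≤ b) → r j = 0
  partial_sum : ∀ x, 0 ≤ ∑ j ∈ Finset.Icc a x, r j ∧ ∑ j ∈ Finset.Icc a x, r j ≤ 1
  sum_eq_one : ∑ j ∈ Finset.Icc a b, r j = 1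

/-- `interlacingLists` for a list that may be empty. -/
noncomputable def interlacingLists' : List ℤ → Finset (List ℤ)
  | [] => ∅
  | k :: L => interlacingLists k L

lemma interlacingSum'_eq_sum {K : List ℤ} (hK : K.Pairwise (· < ·)) (f : List ℤ → ℚ) :
    interlacingSum' K f = ∑ M ∈ interlacingLists' K, f M := by
  cases K with
  | nil => rfl
  | cons k L =>
    have h := List.pairwise_cons.1 hK
    exact interlacingSum_eq_sum h.2 (fun x hx => (h.1 x hx).le) f

/-- The partial sums of the row are the differences of the two counting functions, and its total is
the difference of the lengths. -/
lemma isRow_sub_iff {a b : ℤ} {K M : List ℤ} (hK : K.Pairwise (· < ·))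
    (hM : M.Pairwise (· < ·)) (hKab : ∀ k ∈ K, a ≤ k ∧ k ≤ b) (hMab : ∀ k ∈ M, a ≤ k ∧ k ≤ b) :
    IsRow a b (fun j => listIndicator K j - listIndicator M j) ↔ M ∈ interlacingLists' K := by
  have hs : ∀ x, ∑ j ∈ Finset.Icc a x, (listIndicator K j - listIndicator M j) =
      (countLE K x : ℤ) - countLE M x := by
    intro x
    rw [Finset.sum_sub_distrib, sum_listIndicator hK.nodup _ _ (fun k hk => (hKab k hk).1),
      sum_listIndicator hM.nodup _ _ (fun k hk => (hMab k hk).1)]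
  have hb := hs b
  rw [countLE_eq_length (fun k hk => (hKab k hk).2),
    countLE_eq_length (fun k hk => (hMab k hk).2)] at hb
  cases K with
  | nil =>
    simp only [interlacingLists', Finset.notMem_empty, iff_false]
    intro h
    have := h.sum_eq_one
    rw [hb] at this
    simp only [List.length_nil] at this
    omega
  | cons k L =>
    have h := List.pairwise_cons.1 hK
    simp only [interlacingLists']
    rw [mem_interlacingLists h.2 (fun x hx => (h.1 x hx).le),
      interlaces_iff_countLE (hK.imp le_of_lt) (hM.imp le_of_lt)]
    simp only [List.length_cons] at hb
    constructor
    · intro hr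
      refine ⟨hM, ?_, fun x => ?_⟩
      · have := hr.sum_eq_one
        omega
      · have := hr.partial_sum x
        rw [hs] at this
        omega
    · rintro ⟨_, h1, h2⟩
      refine ⟨fun j hj => ?_, fun x => ?_, by omega⟩
      · have h3 : j ∉ k :: L := fun h => hj (hKab j h)
        have h4 : j ∉ M := fun h => hj (hMab j h)
        simp only [listIndicator, if_neg h3, if_neg h4, sub_self]
      · rw [hs]
        have := h2 x
        omega

lemma mem_interlacingLists'_bounds {K M : List ℤ} (hK : K.Pairwise (· < ·))
    (hM : M ∈ interlacingLists' K) {a b : ℤ} (hKab : ∀ k ∈ K, a ≤ k ∧ k ≤ b) :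
    M.Pairwise (· < ·) ∧ M.length + 1 = K.length ∧ ∀ m ∈ M, a ≤ m ∧ m ≤ b := by
  cases K with
  | nil => simp [interlacingLists'] at hM
  | cons k L =>
    have h := List.pairwise_cons.1 hK
    simp only [interlacingLists'] at hM
    rw [mem_interlacingLists h.2 (fun x hx => (h.1 x hx).le)] at hM
    obtain ⟨h1, h2⟩ := hM
    refine ⟨h1, ?_, fun m hm => ⟨(hKab k (by simp)).1.trans (h2.le (hK.imp le_of_lt) m hm), ?_⟩⟩
    · have := (interlaces_iff_countLE (hK.imp le_of_lt) (h1.imp le_of_lt)).1 h2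
      simp [this.1]
    · clear h1
      induction L generalizing k M with
      | nil => cases h2; simp at hm
      | cons k' L ih =>
        cases M with
        | nil => simp at hm
        | cons m' M =>
          rcases List.mem_cons.1 hm with rfl | hm
          · exact h2.2.1.trans (hKab k' (by simp)).2
          · exact ih k' h.2 (fun x hx => hKab x (List.mem_cons_of_mem _ hx))
              (List.pairwise_cons.1 h.2) h2.2.2 hm

/-- Dropping the first entry of a list leaves a list that interlaces it. -/
lemma interlacingLists'_nonempty {K : List ℤ} (hK : K.Pairwise (· < ·)) (h0 : K ≠ []) :
    (interlacingLists' K).Nonempty := by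
  cases K with
  | nil => exact absurd rfl h0
  | cons k L =>
    have h := List.pairwise_cons.1 hK
    refine ⟨L, ?_⟩
    simp only [interlacingLists']
    rw [mem_interlacingLists h.2 (fun x hx => (h.1 x hx).le)]
    refine ⟨h.2, ?_⟩
    clear h0
    induction L generalizing k with
    | nil => rfl
    | cons k' L ih => exact ⟨(h.1 k' (by simp)).le, le_rfl, ih k' h.2 (List.pairwise_cons.1 h.2)⟩

/-! ### Counting arrays by deleting the bottom row. -/

/-- The arrays whose rows, numbered from the bottom, lie in the columns `a - i, …, b + i`, are
rows of an alternating sign trapezoid and have all partial column sums from the top in `{0, 1}`. -/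
structure IsArray (n : ℕ) (a b : ℤ) (A : Fin n → ℤ → ℤ) : Prop where
  row : ∀ i : Fin n, IsRow (a - (i : ℤ)) (b + (i : ℤ)) (A i)
  column : ∀ i j, 0 ≤ ∑ k ∈ Finset.univ.filter (i ≤ ·), A k j ∧
    ∑ k ∈ Finset.univ.filter (i ≤ ·), A k j ≤ 1

lemma IsArray.sum_mem {n : ℕ} {a b : ℤ} {A : Fin n → ℤ → ℤ} (h : IsArray n a b A) (j : ℤ) :
    0 ≤ ∑ k, A k j ∧ ∑ k, A k j ≤ 1 := by
  cases n with
  | zero => simp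
  | succ n => simpa using h.column 0 j

lemma isArray_cons_iff {n : ℕ} {a b : ℤ} {r : ℤ → ℤ} {A : Fin n → ℤ → ℤ} :
    IsArray (n + 1) a b (Fin.cons r A : Fin (n + 1) → ℤ → ℤ) ↔
      IsRow a b r ∧ IsArray n (a - 1) (b + 1) A ∧
        ∀ j, 0 ≤ r j + ∑ k, A k j ∧ r j + ∑ k, A k j ≤ 1 := by
  have h0 : ∀ j, ∑ k ∈ Finset.univ.filter ((0 : Fin (n + 1)) ≤ ·),
      (Fin.cons r A : Fin (n + 1) → ℤ → ℤ) k j = r j + ∑ k, A k j := by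
    intro j
    simp [Fin.sum_univ_succ]
  have h1 : ∀ (i : Fin n) j, ∑ k ∈ Finset.univ.filter (i.succ ≤ ·),
      (Fin.cons r A : Fin (n + 1) → ℤ → ℤ) k j =
        ∑ k ∈ Finset.univ.filter (i ≤ ·), A k j := by
    intro i j
    simp [Finset.sum_filter, Fin.sum_univ_succ]
  have h2 : ∀ i : Fin n, a - ((i.succ : Fin (n + 1)) : ℤ) = a - 1 - (i : ℤ) := by
    intro i; push_cast [Fin.val_succ]; ring
  have h3 : ∀ i : Fin n, b + ((i.succ : Fin (n + 1)) : ℤ) = b + 1 + (i : ℤ) := by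
    intro i; push_cast [Fin.val_succ]; ring
  constructor
  · intro h
    refine ⟨by simpa using h.row 0, ⟨fun i => ?_, fun i j => ?_⟩, fun j => ?_⟩
    · have := h.row i.succ
      rwa [h2, h3, Fin.cons_succ] at this
    · have := h.column i.succ j
      rwa [h1] at this
    · have := h.column 0 j
      rwa [h0] at this
  · rintro ⟨hr, hA, hc⟩
    refine ⟨fun i => ?_, fun i j => ?_⟩
    · refine Fin.cases (by simpa using hr) (fun i => ?_) i
      rw [h2, h3, Fin.cons_succ]
      exact hA.row i
    · refine Fin.cases ?_ (fun i => ?_) i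
      · rw [h0]
        exact hc j
      · rw [h1]
        exact hA.column i j

/-- All columns with sum `1`, in increasing order: those in `K` and those given by `s`. -/
def fullList : List (Bool × Bool) → ℤ → ℤ → List ℤ → List ℤ
  | [], _, _, K => K
  | (x, y) :: s, a, b, K => fullList s (a - 1) (b + 1) (extendList x y a b K)

lemma mem_extendList {x y : Bool} {a b j : ℤ} {K : List ℤ} :
    j ∈ extendList x y a b K ↔ j ∈ K ∨ (x = true ∧ j = a) ∨ (y = true ∧ j = b) := by
  cases x <;> cases y <;> simp [extendList] <;> tauto

lemma mem_fullList {s : List (Bool × Bool)} {a b : ℤ} {K : List ℤ} {j : ℤ} :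
    j ∈ fullList s a b K ↔ j ∈ K ∨ j ∈ fullList s a b [] := by
  induction s generalizing a b K with
  | nil => simp [fullList]
  | cons xy s ih =>
    obtain ⟨x, y⟩ := xy
    rw [fullList, fullList, ih, ih (K := extendList x y a b []), mem_extendList, mem_extendList]
    simp only [List.not_mem_nil, false_or]
    tauto

lemma le_or_ge_of_mem_fullList {s : List (Bool × Bool)} {a b j : ℤ}
    (h : j ∈ fullList s a b []) : j ≤ a ∨ b ≤ j := by
  induction s generalizing a b with
  | nil => simp [fullList] at h
  | cons xy s ih =>
    obtain ⟨x, y⟩ := xy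
    rw [fullList, mem_fullList, mem_extendList] at h
    rcases h with (h | h | h) | h
    · simp at h
    · exact Or.inl h.2.le
    · exact Or.inr h.2.ge
    · have := ih h
      omega

lemma listIndicator_fullList {s : List (Bool × Bool)} {a b : ℤ} {K : List ℤ}
    (hK : ∀ k ∈ K, a < k ∧ k < b) (j : ℤ) :
    listIndicator (fullList s a b K) j =
      listIndicator K j + listIndicator (fullList s a b []) j := by
  simp only [listIndicator, mem_fullList (K := K)]
  by_cases h1 : j ∈ K <;> by_cases h2 : j ∈ fullList s a b []
  · have := hK j h1
    have := le_or_ge_of_mem_fullList h2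
    omega
  all_goals simp [h1, h2]

lemma pairwise_extendList {x y : Bool} {a b : ℤ} {K : List ℤ} (hab : a < b)
    (hK : K.Pairwise (· < ·)) (hKab : ∀ k ∈ K, a < k ∧ k < b) :
    (extendList x y a b K).Pairwise (· < ·) := by
  cases x <;> cases y <;> simp [extendList, List.pairwise_append, hK] <;> grind

lemma extendList_bounds {x y : Bool} {a b : ℤ} {K : List ℤ} (hab : a < b)
    (hKab : ∀ k ∈ K, a < k ∧ k < b) : ∀ k ∈ extendList x y a b K, a ≤ k ∧ k ≤ b := by
  intro k hk
  rcases mem_extendList.1 hk with h | h | h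
  · have := hKab k h
    omega
  · omega
  · omega

/-- The arrays whose column sums are given by `fullList s a b K`. -/
def arraysWith (n : ℕ) (s : List (Bool × Bool)) (a b : ℤ) (K : List ℤ) :
    Set (Fin n → ℤ → ℤ) :=
  {A | IsArray n a b A ∧ ∀ j, ∑ i, A i j = listIndicator (fullList s a b K) j}

lemma arraysWith_nil {a b : ℤ} {K : List ℤ} :
    arraysWith 0 [] a b K = if K = [] then {Fin.elim0} else ∅ := by
  split_ifs with h
  · ext A
    simp only [arraysWith, Set.mem_ofPred_eq, Set.mem_singleton_iff, h]
    refine ⟨fun _ => Subsingleton.elim _ _, fun _ => ⟨⟨fun i => i.elim0, fun i => i.elim0⟩, ?_⟩⟩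
    simp [fullList, listIndicator]
  · refine Set.eq_empty_of_forall_notMem fun A hA => ?_
    obtain ⟨k, hk⟩ := List.exists_mem_of_ne_nil K h
    have := hA.2 k
    simp [fullList, listIndicator, hk] at this

/-- The upper rows determine `M`, their columns of sum 1 within `a, …, b`, and the prescribed sums
then force the bottom row. Columns outside this range do not meet the bottom row, so their sums are
passed on unchanged through `s`. -/
lemma arraysWith_cons {n : ℕ} {x y : Bool} {s : List (Bool × Bool)} {a b : ℤ} {K : List ℤ}
    (hab : a < b) (hK : K.Pairwise (· < ·)) (hKab : ∀ k ∈ K, a < k ∧ k < b) :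
    arraysWith (n + 1) ((x, y) :: s) a b K =
      ⋃ M ∈ (↑(interlacingLists' (extendList x y a b K)) : Set (List ℤ)),
        (fun A => (Fin.cons (fun j => listIndicator (extendList x y a b K) j - listIndicator M j) A :
          Fin (n + 1) → ℤ → ℤ)) '' arraysWith n s (a - 1) (b + 1) M := by
  have hK' := pairwise_extendList (x := x) (y := y) hab hK hKab
  have hKab' := extendList_bounds (x := x) (y := y) hab hKab
  have hfull := listIndicator_fullList (s := s) (a := a - 1) (b := b + 1)
    (K := extendList x y a b K) (fun k hk => by have := hKab' k hk; omega)
  have h01 : ∀ (L : List ℤ) j, 0 ≤ listIndicator L j ∧ listIndicator L j ≤ 1 := by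
    intro L j
    unfold listIndicator
    split_ifs <;> simp
  ext A
  simp only [Set.mem_iUnion, Set.mem_image, exists_prop, Finset.mem_coe]
  constructor
  · rintro ⟨hA, hs⟩
    obtain ⟨r, A, rfl⟩ : ∃ r A', A = (Fin.cons r A' : Fin (n + 1) → ℤ → ℤ) :=
      ⟨A 0, Fin.tail A, (Fin.cons_self_tail A).symm⟩
    rw [isArray_cons_iff] at hA
    obtain ⟨hr, hA, -⟩ := hA
    simp only [Fin.sum_univ_succ, Fin.cons_zero, Fin.cons_succ, fullList, hfull] at hs
    set M := ((Finset.Icc a b).filter (fun j => ∑ k, A k j = 1)).sort (· ≤ ·) with hM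
    have hMm : ∀ j, j ∈ M ↔ (a ≤ j ∧ j ≤ b) ∧ ∑ k, A k j = 1 := by
      intro j
      simp [hM]
    have hMp : M.Pairwise (· < ·) := (Finset.sortedLT_sort _).pairwise
    have hMi : ∀ j, a ≤ j ∧ j ≤ b → ∑ k, A k j = listIndicator M j := by
      intro j hj
      have := hA.sum_mem j
      unfold listIndicator
      split_ifs with h
      · exact ((hMm j).1 h).2
      · have : ∑ k, A k j ≠ 1 := fun h' => h ((hMm j).2 ⟨hj, h'⟩)
        omega
    have hfi : ∀ j, a ≤ j ∧ j ≤ b → listIndicator (fullList s (a - 1) (b + 1) []) j = 0 := by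
      intro j hj
      refine if_neg fun h => ?_
      have := le_or_ge_of_mem_fullList h
      omega
    have hout : ∀ (L : List ℤ), (∀ k ∈ L, a ≤ k ∧ k ≤ b) → ∀ j, ¬ (a ≤ j ∧ j ≤ b) →
        listIndicator L j = 0 := fun L hL j hj => if_neg fun h => hj (hL j h)
    have hMb : ∀ k ∈ M, a ≤ k ∧ k ≤ b := fun k hk => ((hMm k).1 hk).1
    have hr' : r = fun j => listIndicator (extendList x y a b K) j - listIndicator M j := by
      ext j
      by_cases hj : a ≤ j ∧ j ≤ b
      · have := hs j
        have := hMi j hj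
        have := hfi j hj
        omega
      · rw [hr.eq_zero j hj, hout _ hKab' j hj, hout _ hMb j hj, sub_zero]
    refine ⟨M, ?_, A, ⟨hA, fun j => ?_⟩, by rw [hr']⟩
    · rw [← isRow_sub_iff hK' hMp hKab' hMb, ← hr']
      exact hr
    · rw [listIndicator_fullList (fun k hk => by have := hMb k hk; omega)]
      have := hs j
      rw [hr'] at this
      dsimp only at this
      omega
  · rintro ⟨M, hM, A, ⟨hA, hs⟩, rfl⟩
    obtain ⟨hMp, -, hMb⟩ := mem_interlacingLists'_bounds hK' hM hKab'
    have hs' : ∀ j, listIndicator (extendList x y a b K) j - listIndicator M j + ∑ k, A k j =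
        listIndicator (fullList ((x, y) :: s) a b K) j := by
      intro j
      rw [hs, fullList, hfull,
        listIndicator_fullList (K := M) (fun k hk => by have := hMb k hk; omega)]
      ring
    refine ⟨isArray_cons_iff.2 ⟨(isRow_sub_iff hK' hMp hKab' hMb).2 hM, hA, fun j => ?_⟩,
      fun j => ?_⟩
    · rw [hs']
      exact h01 _ _
    · simp only [Fin.sum_univ_succ, Fin.cons_zero, Fin.cons_succ]
      exact hs' j

lemma eq_of_listIndicator_eq {M N : List ℤ} (hM : M.Pairwise (· < ·)) (hN : N.Pairwise (· < ·))
    (h : ∀ j, listIndicator M j = listIndicator N j) : M = N := by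
  refine List.Pairwise.eq_of_mem_iff hM hN fun j => ?_
  have := h j
  unfold listIndicator at this
  by_cases h1 : j ∈ M <;> by_cases h2 : j ∈ N <;> simp_all

theorem ncard_arraysWith {n : ℕ} {s : List (Bool × Bool)} (hs : s.length = n) {a b : ℤ}
    {K : List ℤ} (hab : a < b) (hK : K.Pairwise (· < ·)) (hKab : ∀ k ∈ K, a < k ∧ k < b) :
    (arraysWith n s a b K).Finite ∧ ((arraysWith n s a b K).ncard : ℚ) = weight s a b K := by
  induction s generalizing n a b K with
  | nil =>
    obtain rfl : 0 = n := hs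
    rw [arraysWith_nil, weight]
    split_ifs <;> simp
  | cons xy s ih =>
    obtain ⟨x, y⟩ := xy
    obtain rfl : s.length + 1 = n := hs
    have hK' := pairwise_extendList (x := x) (y := y) hab hK hKab
    have hKab' := extendList_bounds (x := x) (y := y) hab hKab
    have hM : ∀ M ∈ interlacingLists' (extendList x y a b K), M.Pairwise (· < ·) ∧
        ∀ k ∈ M, a - 1 < k ∧ k < b + 1 := by
      intro M hM
      obtain ⟨h1, -, h2⟩ := mem_interlacingLists'_bounds hK' hM hKab'
      exact ⟨h1, fun k hk => by have := h2 k hk; omega⟩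
    have ih' := fun M hM' => ih rfl (a := a - 1) (b := b + 1) (K := M) (by omega) (hM M hM').1
      (hM M hM').2
    have hfin : ∀ M ∈ (↑(interlacingLists' (extendList x y a b K)) : Set (List ℤ)),
        ((fun A => (Fin.cons
          (fun j => listIndicator (extendList x y a b K) j - listIndicator M j) A :
          Fin (s.length + 1) → ℤ → ℤ)) '' arraysWith s.length s (a - 1) (b + 1) M).Finite :=
      fun M hM => (ih' M hM).1.image _
    rw [arraysWith_cons hab hK hKab]
    refine ⟨(Finset.finite_toSet _).biUnion hfin, ?_⟩
    rw [(Finset.finite_toSet _).ncard_biUnion hfin, finsum_mem_coe_finset, weight,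
      interlacingSum'_eq_sum hK', Nat.cast_sum]
    · refine Finset.sum_congr rfl fun M hM' => ?_
      rw [Set.ncard_image_of_injective, (ih' M hM').2]
      exact fun A B h => (Fin.cons_injective2 h).2
    · intro M hM1 N hN hne
      simp only [Function.onFun, Set.disjoint_left, Set.mem_image, not_exists, not_and]
      rintro _ ⟨A, hA, rfl⟩ B hB h
      -- The pieces are disjoint because `M` can be recovered from the column sums of the upper
      -- rows.
      refine hne (eq_of_listIndicator_eq (hM M hM1).1 (hM N hN).1 fun j => ?_)
      obtain rfl : B = A := (Fin.cons_injective2 h).2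
      have h1 := hA.2 j
      rw [hB.2 j, listIndicator_fullList (hM M hM1).2, listIndicator_fullList (hM N hN).2] at h1
      omega

/-! ### Alternating signs versus partial sums in {0, 1}. -/

section Alternating

variable {ι : Type*} [LinearOrder ι]

/-- The entries are `-1`, `0` or `1`, and the non-zero ones alternate in sign. -/
structure IsAlternating (g : ι → ℤ) : Prop where
  entries : ∀ i, g i = -1 ∨ g i = 0 ∨ g i = 1
  alternating : ∀ i j, i < j → g i ≠ 0 → g j ≠ 0 → (∀ k, i < k → k < j → g k = 0) → g j = -g i

/-- The partial sum of `g` up to and including `i`. -/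
def partialSum (s : Finset ι) (g : ι → ℤ) (i : ι) : ℤ := ∑ k ∈ s.filter (· ≤ i), g k

variable {s : Finset ι} {g : ι → ℤ}

lemma partialSum_eq_add (hs : ∀ i, i ∉ s → g i = 0) {k i : ι} (hki : k < i)
    (h : ∀ j, k < j → j < i → g j = 0) : partialSum s g i = partialSum s g k + g i := by
  have h1 : partialSum s g i =
      ∑ j ∈ s, ((if j ≤ k then g j else 0) + if j = i then g j else 0) := by
    rw [partialSum, Finset.sum_filter]
    refine Finset.sum_congr rfl fun j _ => ?_
    rcases lt_trichotomy j i with hj | rfl | hj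
    · rw [if_pos hj.le, if_neg hj.ne]
      split_ifs with hjk
      · simp
      · simp [h j (not_le.1 hjk) hj]
    · simp [hki.not_ge]
    · rw [if_neg hj.not_ge, if_neg (hki.trans hj).not_ge, if_neg hj.ne', add_zero]
  rw [h1, Finset.sum_add_distrib, ← Finset.sum_filter, Finset.sum_ite_eq']
  split_ifs with hi
  · rfl
  · rw [hs i hi]
    rfl

lemma partialSum_eq_self (hs : ∀ i, i ∉ s → g i = 0) {i : ι} (h : ∀ j, j < i → g j = 0) :
    partialSum s g i = g i := by
  rw [partialSum, Finset.sum_eq_single i]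
  · intro j hj hji
    exact h j (lt_of_le_of_ne (Finset.mem_filter.1 hj).2 hji)
  · intro hi
    exact hs i fun h => hi (Finset.mem_filter.2 ⟨h, le_rfl⟩)

lemma exists_last_ne_zero (hs : ∀ i, i ∉ s → g i = 0) (i : ι) :
    (∀ j, j < i → g j = 0) ∨ ∃ k, k < i ∧ g k ≠ 0 ∧ ∀ j, k < j → j < i → g j = 0 := by
  rcases (s.filter (fun k => k < i ∧ g k ≠ 0)).eq_empty_or_nonempty with h | h
  · left
    intro j hj
    by_contra hne
    have : j ∈ s.filter (fun k => k < i ∧ g k ≠ 0) :=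
      Finset.mem_filter.2 ⟨by by_contra hjs; exact hne (hs j hjs), hj, hne⟩
    simp [h] at this
  · right
    have hm := Finset.max'_mem _ h
    set k := Finset.max' _ h with hk
    obtain ⟨-, h1, h2⟩ := Finset.mem_filter.1 hm
    refine ⟨k, h1, h2, fun j hkj hji => ?_⟩
    by_contra hne
    have : j ∈ s.filter (fun k => k < i ∧ g k ≠ 0) :=
      Finset.mem_filter.2 ⟨by by_contra hjs; exact hne (hs j hjs), hji, hne⟩
    exact hkj.not_ge (Finset.le_max' _ _ this)

/-- Between non-zero entries the partial sum is constant, and at each of them it switches between 0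
and 1, starting with a step up. The induction is on the number of earlier indices in `s`. -/
lemma IsAlternating.partialSum_of_ne_zero (hg : IsAlternating g) (hs : ∀ i, i ∉ s → g i = 0)
    (hpos : ∀ i, g i ≠ 0 → (∀ k, k < i → g k = 0) → 0 < g i) (i : ι) (hi : g i ≠ 0) :
    (g i = 1 ∧ partialSum s g i = 1) ∨ (g i = -1 ∧ partialSum s g i = 0) := by
  obtain ⟨c, hc⟩ : ∃ c, (s.filter (· < i)).card = c := ⟨_, rfl⟩
  induction c using Nat.strong_induction_on generalizing i with
  | _ c ih =>
    rcases exists_last_ne_zero hs i with h | ⟨k, hki, hk, h⟩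
    · rw [partialSum_eq_self hs h]
      have := hpos i hi h
      have := hg.entries i
      omega
    · have hlt : (s.filter (· < k)).card < c := by
        rw [← hc]
        refine Finset.card_lt_card (Finset.ssubset_iff_of_subset ?_ |>.2 ⟨k, ?_, by simp⟩)
        · intro j hj
          simp only [Finset.mem_filter] at hj ⊢
          exact ⟨hj.1, hj.2.trans hki⟩
        · exact Finset.mem_filter.2 ⟨by by_contra hks; exact hk (hs k hks), hki⟩
      have h1 := ih _ hlt k hk rfl
      have h2 := hg.alternating k i hki hk hi h
      rw [partialSum_eq_add hs hki h]
      omega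

lemma IsAlternating.partialSum_mem (hg : IsAlternating g) (hs : ∀ i, i ∉ s → g i = 0)
    (hpos : ∀ i, g i ≠ 0 → (∀ k, k < i → g k = 0) → 0 < g i) (i : ι) :
    0 ≤ partialSum s g i ∧ partialSum s g i ≤ 1 := by
  by_cases hi : g i = 0
  · rcases exists_last_ne_zero hs i with h | ⟨k, hki, hk, h⟩
    · rw [partialSum_eq_self hs h, hi]
      simp
    · rw [partialSum_eq_add hs hki h, hi]
      have := hg.partialSum_of_ne_zero hs hpos k hk
      omega
  · have := hg.partialSum_of_ne_zero hs hpos i hi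
    omega

lemma exists_partialSum_eq_add (hs : ∀ i, i ∉ s → g i = 0)
    (hP : ∀ i, 0 ≤ partialSum s g i ∧ partialSum s g i ≤ 1) (i : ι) :
    ∃ q : ℤ, 0 ≤ q ∧ q ≤ 1 ∧ partialSum s g i = q + g i := by
  rcases exists_last_ne_zero hs i with h | ⟨k, hki, hk, h⟩
  · exact ⟨0, by simp, by simp, by rw [partialSum_eq_self hs h, zero_add]⟩
  · exact ⟨_, (hP k).1, (hP k).2, partialSum_eq_add hs hki h⟩

lemma isAlternating_of_partialSum_mem (hs : ∀ i, i ∉ s → g i = 0)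
    (hP : ∀ i, 0 ≤ partialSum s g i ∧ partialSum s g i ≤ 1) : IsAlternating g := by
  refine ⟨fun i => ?_, fun i j hij hi hj h => ?_⟩
  · obtain ⟨q, h0, h1, hq⟩ := exists_partialSum_eq_add hs hP i
    have := hP i
    omega
  · obtain ⟨q, h0, h1, hq⟩ := exists_partialSum_eq_add hs hP i
    have h2 := partialSum_eq_add hs hij h
    have := hP i
    have := hP j
    omega

lemma pos_of_partialSum_mem (hs : ∀ i, i ∉ s → g i = 0)
    (hP : ∀ i, 0 ≤ partialSum s g i ∧ partialSum s g i ≤ 1) {i : ι} (hi : g i ≠ 0)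
    (h : ∀ k, k < i → g k = 0) : 0 < g i := by
  have h1 := partialSum_eq_self hs h
  have := hP i
  omega

lemma partialSum_max (hne : s.Nonempty) : partialSum s g (s.max' hne) = ∑ k ∈ s, g k := by
  rw [partialSum, Finset.filter_true_of_mem fun k hk => s.le_max' k hk]

/-- Were the first non-zero entry negative, `-g` would have non-negative partial sums, so the total
of `g` would be at most 0. Hence rows need no separate condition on their first non-zero entry. -/
lemma IsAlternating.pos_of_sum_eq_one (hg : IsAlternating g) (hs : ∀ i, i ∉ s → g i = 0)
    (h1 : ∑ k ∈ s, g k = 1) {i : ι} (hi : g i ≠ 0) (h : ∀ k, k < i → g k = 0) : 0 < g i := by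
  by_contra hneg
  have hs' : ∀ i, i ∉ s → (-g) i = 0 := fun i hi => by simp [hs i hi]
  have hne : s.Nonempty := ⟨i, by by_contra his; exact hi (hs i his)⟩
  have hg' : IsAlternating (-g) := by
    refine ⟨fun i => ?_, fun i j hij hi hj h => ?_⟩
    · have := hg.entries i
      simp only [Pi.neg_apply]
      omega
    · simp only [Pi.neg_apply, ne_eq, neg_eq_zero] at hi hj h ⊢
      rw [hg.alternating i j hij hi hj h]
  have := (hg'.partialSum_mem hs' (fun j hj hj' => ?_) (s.max' hne)).1
  · rw [partialSum_max] at this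
    simp only [Pi.neg_apply, Finset.sum_neg_distrib, h1] at this
    omega
  · simp only [Pi.neg_apply, ne_eq, neg_eq_zero] at hj hj' ⊢
    have : j = i := by
      rcases lt_trichotomy j i with hji | hji | hji
      · exact absurd (h j hji) hj
      · exact hji
      · exact absurd (hj' i hji) hi
    rw [this]
    omega

end Alternating

lemma isRow_iff {a b : ℤ} {r : ℤ → ℤ} :
    IsRow a b r ↔ (∀ j, ¬ (a ≤ j ∧ j ≤ b) → r j = 0) ∧ IsAlternating r ∧
      ∑ j ∈ Finset.Icc a b, r j = 1 := by
  have hP : (∀ j, ¬ (a ≤ j ∧ j ≤ b) → r j = 0) →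
      ∀ x, ∑ j ∈ Finset.Icc a x, r j = partialSum (Finset.Icc a b) r x := by
    intro h x
    rw [partialSum]
    symm
    refine Finset.sum_subset (fun j hj => ?_) fun j hj hj' => h j fun hab => hj' ?_
    · simp only [Finset.mem_filter, Finset.mem_Icc] at hj ⊢
      omega
    · simp only [Finset.mem_filter, Finset.mem_Icc] at hj ⊢
      omega
  constructor
  · intro h
    have hs : ∀ j, j ∉ Finset.Icc a b → r j = 0 := fun j hj => h.eq_zero j (by simpa using hj)
    refine ⟨h.eq_zero, isAlternating_of_partialSum_mem hs fun i => ?_, h.sum_eq_one⟩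
    rw [← hP h.eq_zero]
    exact h.partial_sum i
  · rintro ⟨h0, ha, h1⟩
    have hs : ∀ j, j ∉ Finset.Icc a b → r j = 0 := fun j hj => h0 j (by simpa using hj)
    refine ⟨h0, fun x => ?_, h1⟩
    rw [hP h0]
    exact ha.partialSum_mem hs (fun i hi h => ha.pos_of_sum_eq_one hs h1 hi h) x

lemma column_iff {n : ℕ} {c : Fin n → ℤ} :
    (∀ i, 0 ≤ ∑ k ∈ Finset.univ.filter (i ≤ ·), c k ∧
      ∑ k ∈ Finset.univ.filter (i ≤ ·), c k ≤ 1) ↔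
    (∀ i, c i = -1 ∨ c i = 0 ∨ c i = 1) ∧
    (∀ i i' : Fin n, i < i' → c i ≠ 0 → c i' ≠ 0 → (∀ k, i < k → k < i' → c k = 0) →
      c i' = -c i) ∧
    ∀ i, c i ≠ 0 → (∀ k, i < k → c k = 0) → 0 < c i := by
  -- Rows are numbered from the bottom but columns are read from the top, hence the dual order.
  let g : (Fin n)ᵒᵈ → ℤ := fun i => c (OrderDual.ofDual i)
  have hs : ∀ i, i ∉ (Finset.univ : Finset (Fin n)ᵒᵈ) → g i = 0 := by simp
  have hP : ∀ i : Fin n, ∑ k ∈ Finset.univ.filter (i ≤ ·), c k =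
      partialSum Finset.univ g (OrderDual.toDual i) := by
    intro i
    rw [partialSum, Finset.sum_filter, Finset.sum_filter]
    exact Fintype.sum_equiv OrderDual.toDual _ _ fun k => rfl
  simp only [hP]
  constructor
  · intro h
    have hg := isAlternating_of_partialSum_mem (g := g) hs h
    refine ⟨hg.entries, fun i i' hii' hi hi' hk => ?_, fun i hi hk => ?_⟩
    · have := hg.alternating (OrderDual.toDual i') (OrderDual.toDual i) hii' hi' hi
        fun k h1 h2 => hk (OrderDual.ofDual k) h2 h1
      exact (neg_eq_iff_eq_neg.2 this).symm
    · exact pos_of_partialSum_mem (g := g) hs h (i := OrderDual.toDual i) hi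
        fun k h1 => hk (OrderDual.ofDual k) h1
  · rintro ⟨h1, h2, h3⟩ i
    refine IsAlternating.partialSum_mem (g := g) ⟨h1, fun i j hij hi hj hk => ?_⟩ hs
      (fun i hi hk => ?_) _
    · have := h2 (OrderDual.ofDual j) (OrderDual.ofDual i) hij hj hi
        fun k h1 h2 => hk (OrderDual.toDual k) h2 h1
      exact (neg_eq_iff_eq_neg.2 this).symm
    · exact h3 (OrderDual.ofDual i) hi fun k hk' => hk (OrderDual.toDual k) hk'

lemma isASTrapezoid_iff {n l : ℕ} {A : Fin n → ℤ → ℤ} :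
    IsASTrapezoid n l A ↔ IsArray n 0 l A ∧
      ∀ j : ℤ, 1 ≤ j → j ≤ (l : ℤ) - 1 → ∑ i : Fin n, A i j = 0 := by
  constructor
  · intro h
    refine ⟨⟨fun i => ?_, fun i j => ?_⟩, h.central_col_sum⟩
    · rw [isRow_iff, zero_sub]
      exact ⟨h.eq_zero_outside i, ⟨h.entries i, h.row_alternating i⟩, h.row_sum i⟩
    · revert i
      exact column_iff.2 ⟨fun i => h.entries i j, fun i i' => h.col_alternating i i' j,
        fun i => h.col_top_pos i j⟩
  · rintro ⟨h, hc⟩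
    have hr := fun i => isRow_iff.1 (h.row i)
    simp only [zero_sub] at hr
    have hcol := fun j => column_iff.1 fun i => h.column i j
    exact ⟨fun i => (hr i).1, fun i => (hr i).2.1.entries, fun i => (hr i).2.2, hc,
      fun i => (hr i).2.1.alternating, fun i i' j => (hcol j).2.1 i i', fun i j => (hcol j).2.2 i⟩

/-! ### From centred Catalan sets to prescribed column sums. -/

/-- For `j < i ≤ j + m` in turn: whether `-i` and `i` belong to `S`. -/
def membershipPairs (S : Finset ℤ) : ℕ → ℕ → List (Bool × Bool)
  | _, 0 => []
  | j, m + 1 =>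
    (decide (-((j : ℤ) + 1) ∈ S), decide ((j : ℤ) + 1 ∈ S)) :: membershipPairs S (j + 1) m

lemma length_membershipPairs (S : Finset ℤ) (j m : ℕ) : (membershipPairs S j m).length = m := by
  induction m generalizing j with
  | zero => rfl
  | succ m ih => simp [membershipPairs, ih]

lemma mem_fullList_membershipPairs {S : Finset ℤ} {j m : ℕ} {a b x : ℤ} :
    x ∈ fullList (membershipPairs S j m) a b [] ↔
      (x ≤ a ∧ a - m < x ∧ x - a - j - 1 ∈ S) ∨ (b ≤ x ∧ x < b + m ∧ x - b + j + 1 ∈ S) := by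
  induction m generalizing j a b with
  | zero =>
    simp only [membershipPairs, fullList, List.not_mem_nil, false_iff]
    push_cast
    omega
  | succ m ih =>
    rw [membershipPairs, fullList, mem_fullList, mem_extendList, ih]
    simp only [List.not_mem_nil, false_or, decide_eq_true_eq]
    have e1 : x - (a - 1) - ((j + 1 : ℕ) : ℤ) - 1 = x - a - j - 1 := by push_cast; ring
    have e2 : x - (b + 1) + ((j + 1 : ℕ) : ℤ) + 1 = x - b + j + 1 := by push_cast; ring
    rw [e1, e2]
    have f1 : x = a → x - a - j - 1 = -((j : ℤ) + 1) := by rintro rfl; ring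
    have f2 : x = b → x - b + j + 1 = (j : ℤ) + 1 := by rintro rfl; ring
    push_cast
    constructor
    · rintro ((⟨h, hx⟩ | ⟨h, hx⟩) | ⟨h1, h2, h⟩ | ⟨h1, h2, h⟩)
      · exact Or.inl ⟨by omega, by omega, by rwa [f1 hx]⟩
      · exact Or.inr ⟨by omega, by omega, by rwa [f2 hx]⟩
      · exact Or.inl ⟨by omega, by omega, h⟩
      · exact Or.inr ⟨by omega, by omega, h⟩
    · rintro (⟨h1, h2, h⟩ | ⟨h1, h2, h⟩)
      · by_cases hx : x = a
        · exact Or.inl (Or.inl ⟨by rwa [f1 hx] at h, hx⟩)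
        · exact Or.inr (Or.inl ⟨by omega, by omega, h⟩)
      · by_cases hx : x = b
        · exact Or.inl (Or.inr ⟨by rwa [f2 hx] at h, hx⟩)
        · exact Or.inr (Or.inr ⟨by omega, by omega, h⟩)

lemma IsCentredCatalanSet.zero_mem {n : ℕ} {S : Finset ℤ} (hS : IsCentredCatalanSet n S) :
    (0 : ℤ) ∈ S := by
  have h := hS.le_card_inter 0 hS.pos
  obtain ⟨x, hx⟩ := Finset.card_pos.1 (show 0 < (S ∩ Finset.Icc (-((0 : ℕ) : ℤ)) (0 : ℕ)).card by
    omega)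
  simp only [Finset.mem_inter, Finset.mem_Icc, Nat.cast_zero, neg_zero] at hx
  obtain rfl : x = 0 := by omega
  exact hx.1

lemma mem_trapezoidSet {n l : ℕ} {A : Fin n → ℤ → ℤ} (hl : 1 ≤ l)
    (hc : ∀ j : ℤ, 1 ≤ j → j ≤ (l : ℤ) - 1 → ∑ i : Fin n, A i j = 0) {x : ℤ} :
    x ∈ trapezoidSet n l A ↔ x = 0 ∨ (x < 0 ∧ -(n : ℤ) ≤ x ∧ 0 < ∑ i, A i (x + 1)) ∨
      (0 < x ∧ x ≤ n ∧ 0 < ∑ i, A i (x + l - 1)) := by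
  simp only [trapezoidSet, Finset.mem_insert, Finset.mem_image, Finset.mem_filter, Finset.mem_Icc]
  refine or_congr_right ?_
  constructor
  · rintro ⟨j, ⟨⟨h1, h2⟩, h3⟩, h⟩
    split_ifs at h with hj
    · subst h
      exact Or.inl ⟨by omega, by omega, by rwa [sub_add_cancel]⟩
    · have hj' : ¬ j ≤ (l : ℤ) - 1 := by
        intro h'
        rw [hc j (by omega) h'] at h3
        omega
      subst h
      refine Or.inr ⟨by omega, by omega, ?_⟩
      rwa [show j - ((l : ℤ) - 1) + l - 1 = j by ring]
  · rintro (⟨h1, h2, h3⟩ | ⟨h1, h2, h3⟩)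
    · exact ⟨x + 1, ⟨⟨by omega, by omega⟩, h3⟩, by rw [if_pos (by omega)]; ring⟩
    · exact ⟨x + l - 1, ⟨⟨by omega, by omega⟩, h3⟩, by rw [if_neg (by omega)]; ring⟩

lemma IsArray.sum_eq_zero {n : ℕ} {a b : ℤ} {A : Fin n → ℤ → ℤ} (h : IsArray n a b A) {j : ℤ}
    (hj : j ≤ a - n ∨ b + n ≤ j) : ∑ i, A i j = 0 :=
  Finset.sum_eq_zero fun i _ => (h.row i).eq_zero j (by have := i.2; omega)

/-- Row `i` introduces the columns `-i` and `l + i`, whose relabelled values are `-(i + 1)` and `i +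
1`. Starting from the empty list makes the central columns sum to 0. -/
lemma setOf_trapezoid_eq {n l : ℕ} {S : Finset ℤ} (hS : IsCentredCatalanSet (n + 1) S)
    (hl : 1 ≤ l) :
    {A : Fin n → ℤ → ℤ | IsASTrapezoid n l A ∧ trapezoidSet n l A = S} =
      arraysWith n (membershipPairs S 0 n) 0 l [] := by
  have hmem : ∀ j : ℤ, j ∈ fullList (membershipPairs S 0 n) 0 l [] ↔
      (j ≤ 0 ∧ -(n : ℤ) < j ∧ j - 1 ∈ S) ∨ ((l : ℤ) ≤ j ∧ j < l + n ∧ j - l + 1 ∈ S) := by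
    intro j
    rw [mem_fullList_membershipPairs]
    simp
  ext A
  simp only [arraysWith, Set.mem_ofPred_eq, isASTrapezoid_iff]
  constructor
  · rintro ⟨⟨hA, hc⟩, rfl⟩
    refine ⟨hA, fun j => ?_⟩
    have h01 := hA.sum_mem j
    have e1 : j - 1 + 1 = j := by ring
    have e2 : j - (l : ℤ) + 1 + l - 1 = j := by ring
    have hj : j ∈ fullList (membershipPairs (trapezoidSet n l A) 0 n) 0 l [] ↔
        0 < ∑ i, A i j := by
      rw [hmem, mem_trapezoidSet hl hc, mem_trapezoidSet hl hc, e1, e2]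
      constructor
      · rintro (⟨h1, h2, h3 | h3 | h3⟩ | ⟨h1, h2, h3 | h3 | h3⟩) <;> omega
      · intro h
        by_cases h1 : j ≤ 0
        · have : -(n : ℤ) < j := by
            by_contra h2
            rw [hA.sum_eq_zero (by omega)] at h
            omega
          exact Or.inl ⟨h1, this, Or.inr (Or.inl ⟨by omega, by omega, h⟩)⟩
        · have h2 : ¬ j ≤ (l : ℤ) - 1 := by
            intro h2
            rw [hc j (by omega) h2] at h
            omega
          have : j < (l : ℤ) + n := by
            by_contra h2
            rw [hA.sum_eq_zero (by omega)] at h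
            omega
          exact Or.inr ⟨by omega, this, Or.inr (Or.inr ⟨by omega, by omega, h⟩)⟩
    unfold listIndicator
    split_ifs with h
    · have := hj.1 h
      omega
    · rw [hj] at h
      omega
  · rintro ⟨hA, hs⟩
    have hc : ∀ j : ℤ, 1 ≤ j → j ≤ (l : ℤ) - 1 → ∑ i : Fin n, A i j = 0 := by
      intro j h1 h2
      rw [hs j]
      refine if_neg fun h => ?_
      rw [hmem] at h
      omega
    have hpos : ∀ j, 0 < ∑ i : Fin n, A i j ↔
        (j ≤ 0 ∧ -(n : ℤ) < j ∧ j - 1 ∈ S) ∨ ((l : ℤ) ≤ j ∧ j < l + n ∧ j - l + 1 ∈ S) := by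
      intro j
      rw [hs j, ← hmem]
      unfold listIndicator
      split_ifs with h <;> simp [h]
    refine ⟨⟨hA, hc⟩, ?_⟩
    ext x
    have e1 : x + 1 - 1 = x := by ring
    have e2 : x + l - 1 - (l : ℤ) + 1 = x := by ring
    rw [mem_trapezoidSet hl hc, hpos, hpos, e1, e2]
    constructor
    · rintro (rfl | ⟨h1, h2, h3 | h3⟩ | ⟨h1, h2, h3 | h3⟩)
      · exact hS.zero_mem
      · exact h3.2.2
      · omega
      · omega
      · exact h3.2.2
    · intro hx
      have hb := Finset.mem_Icc.1 (hS.subset_Icc hx)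
      push_cast at hb
      rcases lt_trichotomy x 0 with h | h | h
      · exact Or.inr (Or.inl ⟨h, by omega, Or.inl ⟨by omega, by omega, hx⟩⟩)
      · exact Or.inl h
      · exact Or.inr (Or.inr ⟨h, by omega, Or.inr ⟨by omega, by omega, hx⟩⟩)

lemma trapezoidWeight_eq_weight {n l : ℕ} {S : Finset ℤ} (hS : IsCentredCatalanSet (n + 1) S)
    (hl : 1 ≤ l) : (trapezoidWeight n l S : ℚ) = weight (membershipPairs S 0 n) 0 l [] := by
  rw [trapezoidWeight, setOf_trapezoid_eq hS hl]
  exact (ncard_arraysWith (length_membershipPairs S 0 n) (by omega) List.Pairwise.nil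
    (by simp)).2

/-! ### Positivity from the Catalan condition. -/

/-- Starting from `e` entries, the rows described by `s` are non-empty and end with no entry. -/
def IsBalanced : List (Bool × Bool) → ℕ → Prop
  | [], e => e = 0
  | (x, y) :: s, e => ∃ e', e + x.toNat + y.toNat = e' + 1 ∧ IsBalanced s e'

lemma length_extendList (x y : Bool) (a b : ℤ) (K : List ℤ) :
    (extendList x y a b K).length = K.length + x.toNat + y.toNat := by
  cases x <;> cases y <;> simp [extendList]

/-- Each row adds its prescribed columns and interlacing then removes one entry. Balance keeps every
list to be interlaced non-empty, so at each stage there is a term and all terms are positive. -/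
theorem weight_pos {s : List (Bool × Bool)} {a b : ℤ} {K : List ℤ} (hs : IsBalanced s K.length)
    (hab : a < b) (hK : K.Pairwise (· < ·)) (hKab : ∀ k ∈ K, a < k ∧ k < b) :
    0 < weight s a b K := by
  induction s generalizing a b K with
  | nil =>
    obtain rfl := List.length_eq_zero_iff.1 hs
    simp [weight]
  | cons xy s ih =>
    obtain ⟨x, y⟩ := xy
    obtain ⟨e, he, hs⟩ := hs
    have hK' := pairwise_extendList (x := x) (y := y) hab hK hKab
    have hKab' := extendList_bounds (x := x) (y := y) hab hKab
    rw [← length_extendList x y a b] at he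
    rw [weight, interlacingSum'_eq_sum hK']
    refine Finset.sum_pos (fun M hM => ?_) (interlacingLists'_nonempty hK' ?_)
    · obtain ⟨h1, h2, h3⟩ := mem_interlacingLists'_bounds hK' hM hKab'
      refine ih ?_ (by omega) h1 fun k hk => by have := h3 k hk; omega
      rwa [show M.length = e by omega]
    · intro h
      simp [h] at he

/-- After `j` rows the list has |S ∩ {-j, …, j}| - (j + 1) entries: the Catalan inequality keeps
this non-negative, and the size of `S` makes it 0 at the end. -/
lemma IsCentredCatalanSet.isBalanced {n : ℕ} {S : Finset ℤ} (hS : IsCentredCatalanSet (n + 1) S)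
    {j m e : ℕ} (hjm : j + m = n)
    (he : (S ∩ Finset.Icc (-(j : ℤ)) j).card = j + 1 + e) :
    IsBalanced (membershipPairs S j m) e := by
  induction m generalizing j e with
  | zero =>
    obtain rfl : j = n := hjm
    have h := hS.subset_Icc
    rw [show -((j + 1 : ℕ) : ℤ) + 1 = -j by push_cast; ring,
      show ((j + 1 : ℕ) : ℤ) - 1 = j by push_cast; ring] at h
    rw [Finset.inter_eq_left.2 h, hS.card_eq] at he
    show e = 0
    omega
  | succ m ih =>
    have hcard : (S ∩ Finset.Icc (-((j + 1 : ℕ) : ℤ)) (j + 1 : ℕ)).card =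
        (S ∩ Finset.Icc (-(j : ℤ)) j).card + (decide (-((j : ℤ) + 1) ∈ S)).toNat +
          (decide ((j : ℤ) + 1 ∈ S)).toNat := by
      have hI : Finset.Icc (-((j + 1 : ℕ) : ℤ)) (j + 1 : ℕ) =
          insert ((j : ℤ) + 1) (insert (-((j : ℤ) + 1)) (Finset.Icc (-(j : ℤ)) j)) := by
        ext x
        simp only [Finset.mem_Icc, Finset.mem_insert]
        omega
      have n1 : (j : ℤ) + 1 ∉ S ∩ Finset.Icc (-(j : ℤ)) j := by simp
      have n2 : -((j : ℤ) + 1) ∉ S ∩ Finset.Icc (-(j : ℤ)) j := by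
        simp only [Finset.mem_inter, Finset.mem_Icc]
        omega
      have n3 : (j : ℤ) + 1 ≠ -((j : ℤ) + 1) := by omega
      rw [hI]
      by_cases h1 : (j : ℤ) + 1 ∈ S <;> by_cases h2 : -((j : ℤ) + 1) ∈ S
      · rw [Finset.inter_insert_of_mem h1, Finset.inter_insert_of_mem h2,
          Finset.card_insert_of_notMem, Finset.card_insert_of_notMem n2]
        · simp only [h1, h2, decide_true, Bool.toNat_true]
        · rw [Finset.mem_insert]
          tauto
      · rw [Finset.inter_insert_of_mem h1, Finset.inter_insert_of_notMem h2,
          Finset.card_insert_of_notMem n1]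
        simp only [h1, h2, decide_true, decide_false, Bool.toNat_true, Bool.toNat_false, add_zero]
      · rw [Finset.inter_insert_of_notMem h1, Finset.inter_insert_of_mem h2,
          Finset.card_insert_of_notMem n2]
        simp only [h1, h2, decide_true, decide_false, Bool.toNat_true, Bool.toNat_false, add_zero]
      · rw [Finset.inter_insert_of_notMem h1, Finset.inter_insert_of_notMem h2]
        simp only [h1, h2, decide_false, Bool.toNat_false, add_zero]
    have h := hS.le_card_inter (j + 1) (by omega)
    refine ⟨(S ∩ Finset.Icc (-((j + 1 : ℕ) : ℤ)) (j + 1 : ℕ)).card - (j + 2), by omega,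
      ih (by omega) (by omega)⟩

/-! ### Evaluation at -1 and -2, and divisibility. -/

/-- With both ends the list is [0, -1]: the signed sum contributes minus the value at [-1] and the
boundary term plus the same value. With one end a positive weight with bounds -1 < 0 remains;
balance rules out having neither. -/
lemma IsBalanced.weight_neg_one {x y : Bool} {s : List (Bool × Bool)}
    (h : IsBalanced ((x, y) :: s) 0) :
    weight ((x, y) :: s) 0 (-1) [] = 0 ↔ x = true ∧ y = true := by
  obtain ⟨e, he, hs⟩ := h
  have hpos : e = 0 → 0 < weight s (-1) 0 [] := by
    rintro rfl
    exact weight_pos hs (by omega) List.Pairwise.nil (by simp)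
  cases x <;> cases y <;> simp at he
  · simpa [weight, extendList, interlacingSum', interlacingSum] using (hpos he).ne'
  · simpa [weight, extendList, interlacingSum', interlacingSum] using (hpos he).ne'
  · simp [weight, extendList, interlacingSum', interlacingSum, signedSum]
    rw [show Finset.Ico (-1 : ℤ) 0 = {-1} from rfl]
    simp

/-- The list [0, -2] leaves only minus the value at [-1], and both bounds move to -1. The next row
then interlaces one, two or three copies of -1. With three, the cancellation seen at l = -1 recurs;
with fewer, a positive weight with bounds -2 < 0 remains. -/
lemma IsBalanced.weight_neg_two {x y : Bool} {s : List (Bool × Bool)}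
    (h : IsBalanced ((true, true) :: (x, y) :: s) 0) :
    weight ((true, true) :: (x, y) :: s) 0 (-2) [] = 0 ↔ x = true ∧ y = true := by
  obtain ⟨e, he, e', he', hs⟩ := h
  obtain rfl : e = 1 := by simpa using he.symm
  have h1 : ∀ t, weight ((true, true) :: t) 0 (-2) [] = - weight t (-1) (-1) [-1] := by
    intro t
    simp [weight, extendList, interlacingSum', interlacingSum, signedSum]
    rw [show Finset.Ico (-2 : ℤ) 0 = {-2, -1} from rfl]
    simp
  rw [h1, neg_eq_zero]
  have hpos0 : e' = 0 → 0 < weight s (-2) 0 [] := by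
    rintro rfl
    exact weight_pos hs (by omega) List.Pairwise.nil (by simp)
  have hpos1 : e' = 1 → 0 < weight s (-2) 0 [-1] := by
    rintro rfl
    exact weight_pos hs (by omega) (by simp) (by simp)
  cases x <;> cases y <;> simp at he'
  · simpa [weight, extendList, interlacingSum', interlacingSum, signedSum] using (hpos0 he').ne'
  · simpa [weight, extendList, interlacingSum', interlacingSum, signedSum] using (hpos1 he').ne'
  · simpa [weight, extendList, interlacingSum', interlacingSum, signedSum] using (hpos1 he').ne'
  · simp [weight, extendList, interlacingSum', interlacingSum, signedSum]
    rw [show Finset.Ico (-1 : ℤ) 0 = {-1} from rfl]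
    simp

lemma X_add_one_dvd_iff (w : ℚ[X]) : (X + 1 : ℚ[X]) ∣ w ↔ w.eval (-1) = 0 := by
  rw [show (X + 1 : ℚ[X]) = X - C (-1) by simp, dvd_iff_isRoot, IsRoot]

lemma X_add_two_dvd_iff (w : ℚ[X]) : (X + 2 : ℚ[X]) ∣ w ↔ w.eval (-2) = 0 := by
  rw [show (X + 2 : ℚ[X]) = X - C (-2) by rw [C_neg, sub_neg_eq_add]; rfl, dvd_iff_isRoot, IsRoot]

lemma X_add_one_mul_dvd_iff (w : ℚ[X]) :
    ((X + 1) * (X + 2) : ℚ[X]) ∣ w ↔ w.eval (-1) = 0 ∧ w.eval (-2) = 0 := by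
  rw [← X_add_one_dvd_iff, ← X_add_two_dvd_iff]
  constructor
  · exact fun h => ⟨(dvd_mul_right _ _).trans h, (dvd_mul_left _ _).trans h⟩
  · rintro ⟨h1, h2⟩
    -- Bézout: -(X + 1) + (X + 2) = 1.
    exact IsCoprime.mul_dvd ⟨-1, 1, by ring⟩ h1 h2

/-- For a centred Catalan set `S` of size `n + 1`, the weight `w_l(S)`, `l ≥ 1`, is given by a
(necessarily unique) polynomial `w` in `l`, and `w` satisfies both divisibility criteria. -/
theorem mainTheorem5 (n : ℕ) (S : Finset ℤ) (hS : IsCentredCatalanSet (n + 1) S) :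
    ∃ w : ℚ[X],
      (∀ l : ℕ, 1 ≤ l → w.eval (l : ℚ) = (trapezoidWeight n l S : ℚ)) ∧
      (({-1, 1} : Finset ℤ) ⊆ S ↔ (X + 1 : ℚ[X]) ∣ w) ∧
      (({-2, -1, 1, 2} : Finset ℤ) ⊆ S ↔ ((X + 1) * (X + 2) : ℚ[X]) ∣ w) := by
  obtain ⟨w, hw⟩ := exists_polynomial_eval_eq_weight (membershipPairs S 0 n)
  refine ⟨w, fun l hl => ?_, ?_⟩
  · rw [trapezoidWeight_eq_weight hS hl]
    exact_mod_cast hw l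
  have hw1 := hw (-1)
  have hw2 := hw (-2)
  push_cast at hw1 hw2
  have hb : IsBalanced (membershipPairs S 0 n) 0 :=
    hS.isBalanced (zero_add n) (by
      have := Finset.inter_singleton_of_mem hS.zero_mem
      simp [this])
  have hSb : ∀ x ∈ S, -(n : ℤ) ≤ x ∧ x ≤ n := fun x hx => by
    have := Finset.mem_Icc.1 (hS.subset_Icc hx)
    push_cast at this
    omega
  rw [X_add_one_dvd_iff, X_add_one_mul_dvd_iff, hw1, hw2]
  simp only [Finset.insert_subset_iff, Finset.singleton_subset_iff]
  cases n with
  | zero =>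
    have h1 : (1 : ℤ) ∉ S := fun h => by have := hSb 1 h; omega
    simp [membershipPairs, weight, h1]
  | succ n =>
    simp only [membershipPairs] at hb ⊢
    rw [hb.weight_neg_one]
    simp only [decide_eq_true_eq, Nat.cast_zero, zero_add]
    refine ⟨trivial, ?_⟩
    by_cases h11 : -1 ∈ S ∧ 1 ∈ S
    · simp only [h11, Nat.cast_zero, zero_add, decide_true, true_and] at hb ⊢
      cases n with
      | zero =>
        -- Here `S` would have size 2 yet contain -1, 0 and 1, which contradicts balance.
        obtain ⟨e, he, hs⟩ := hb
        obtain rfl : e = 0 := hs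
        simp at he
      | succ n =>
        simp only [membershipPairs] at hb ⊢
        rw [hb.weight_neg_two]
        norm_num
    · tauto
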